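/- Let $\mathcal{A}$ be a Krull–Schmidt additive category (every object is a finite direct sum of objects with local endomorphism rings) and let $(\mathcal{A},\mathbb{E},\mathfrak{s})$ be an extriangulated category in the sense of Nakaoka and Palu: $\mathbb{E}\colon\mathcal{A}^{\mathrm{op}}\times\mathcal{A}\to\mathrm{Ab}$ is an additive bifunctor and $\mathfrak{s}$ is an additive realization, assigning to each $\delta\in\mathbb{E}(M,X)$ an equivalence class $\mathfrak{s}(\delta)=[X\to L\to M]$, such that the axioms (ET1)–(ET4), (ET3)$^{\mathrm{op}}$, (ET4)$^{\mathrm{op}}$ hold. If $\mathfrak{s}(\delta)=[X\xrightarrow{x}L\xrightarrow{y}M]$, then $X\xrightarrow{x}L\xrightarrow{y}M\overset{\delta}{\dashrightarrow}$ is called an $\mathbb{E}$-triangle. A map $\Theta$ from the set of isomorphism classes of objects of $\mathcal{A}$ to $\mathbb{N}=\{0,1,2,\dots\}$ is a *length function* on $(\mathcal{A},\mathbb{E},\mathfrak{s})$ if $\Theta(X)=0$ exactly when $X\cong 0$, and for every $\mathbb{E}$-triangle $X\to L\to M\overset{\delta}{\dashrightarrow}$ one has $\Theta(L)\le\Theta(X)+\Theta(M)$,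 with equality if $\delta=0$. It is *stable* if $\Theta(L)=\Theta(X)+\Theta(M)$ for every $\mathbb{E}$-triangle. An $\mathbb{E}$-triangle $X\xrightarrow{x}L\xrightarrow{y}M\overset{\delta}{\dashrightarrow}$ with $\Theta(L)=\Theta(X)+\Theta(M)$ is called *$\Theta$-stable*; then $x$ is called a $\Theta$-inflation, $y$ a $\Theta$-deflation and $\delta$ a $\Theta$-extension. The pair $((\mathcal{A},\mathbb{E},\mathfrak{s}),\Theta)$ is a *length category* if $\Theta$ is a length function and every morphism $f$ of $\mathcal{A}$ factors as $f=j\circ i$ with $i$ a $\Theta$-deflation and $j$ a $\Theta$-inflation; it is a *stable length category* if moreover $\Theta$ is stable. Let $\mathbb{E}_\Theta(M,X)\subseteq\mathbb{E}(M,X)$ be the set of all $\Theta$-extensions, and let $\mathfrak{s}_\Theta$ be the restriction of $\mathfrak{s}$ to $\mathbb{E}_\Theta$. **Proposition.** If $((\mathcal{A},\mathbb{E},\mathfrak{s}),\Theta)$ is a length category, then $\mathbb{E}_\Theta$ is an additive subfunctor of $\mathbb{E}$ (each $\mathbb{E}_\Theta(M,X)$ is a subgroup of $\mathbb{E}(M,X)$,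 and these subgroups are preserved by the maps $\mathbb{E}(c,a)$), the triple $(\mathcal{A},\mathbb{E}_\Theta,\mathfrak{s}_\Theta)$ is an extriangulated category, and $((\mathcal{A},\mathbb{E}_\Theta,\mathfrak{s}_\Theta),\Theta)$ is a stable length category. -/

import Mathlib

open CategoryTheory CategoryTheory.Limits Opposite

universe w v u

attribute [local instance] hasBinaryBiproducts_of_finite_biproducts

noncomputable section

namespace Extri

variable {C : Type u} [Category.{v} C]

/-! ### Bifunctors to abelian groups -/

/-- The group `𝔼(Z, X)` of extensions, contravariant in `Z` and covariant in `X`. -/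
abbrev Ext (E : Cᵒᵖ ⥤ C ⥤ AddCommGrpCat.{w}) (Z X : C) : Type w :=
  (E.obj (op Z)).obj X

/-- `a_* δ = 𝔼(Z, a)(δ)`. -/
def push (E : Cᵒᵖ ⥤ C ⥤ AddCommGrpCat.{w}) {Z X X' : C} (a : X ⟶ X') (δ : Ext E Z X) :
    Ext E Z X' :=
  ((E.obj (op Z)).map a).hom δ

/-- `c^* δ = 𝔼(c, X)(δ)`. -/
def pull (E : Cᵒᵖ ⥤ C ⥤ AddCommGrpCat.{w}) {Z Z' X : C} (c : Z' ⟶ Z) (δ : Ext E Z X) :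
    Ext E Z' X :=
  ((E.map c.op).app X).hom δ

/-! ### Equivalence classes of sequences and realizations -/

/-- A sequence `X ⟶ Y ⟶ Z` with fixed ends `X` and `Z`. -/
structure Seq (X Z : C) where
  /-- the middle term -/
  mid : C
  /-- the first morphism -/
  i : X ⟶ mid
  /-- the second morphism -/
  p : mid ⟶ Z

/-- Two sequences with the same ends are equivalent if there is an isomorphism of the middle terms
that is compatible with the identities of the ends. -/
def Seq.Equiv {X Z : C} (S T : Seq X Z) : Prop :=
  ∃ h : S.mid ≅ T.mid, S.i ≫ h.hom = T.i ∧ h.hom ≫ T.p = S.p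

theorem Seq.equiv_equivalence (X Z : C) : Equivalence (Seq.Equiv (X := X) (Z := Z)) where
  refl S := ⟨Iso.refl _, by simp, by simp⟩
  symm := by
    rintro S T ⟨h, h₁, h₂⟩
    exact ⟨h.symm, by simp [← h₁], by simp [← h₂]⟩
  trans := by
    rintro S T U ⟨h, h₁, h₂⟩ ⟨k, k₁, k₂⟩
    exact ⟨h.trans k, by simp [← h₁, ← k₁], by simp [← h₂, ← k₂]⟩

instance Seq.setoid (X Z : C) : Setoid (Seq X Z) := ⟨Seq.Equiv, Seq.equiv_equivalence X Z⟩

/-- A correspondence `𝔰` that assigns to every `δ ∈ 𝔼(Z, X)` an equivalence class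
`[X ⟶ Y ⟶ Z]` of sequences. -/
abbrev Correspondence (E : Cᵒᵖ ⥤ C ⥤ AddCommGrpCat.{w}) :=
  ∀ ⦃Z X : C⦄, Ext E Z X → Quotient (Seq.setoid X Z)

/-- `X ⟶ Y ⟶ Z ⇢` (with morphisms `x`, `y` and extension `δ`) is an `𝔼`-triangle:
`𝔰(δ) = [X ⟶ Y ⟶ Z]`. -/
def IsTriangle {E : Cᵒᵖ ⥤ C ⥤ AddCommGrpCat.{w}} (s : Correspondence E) {X Y Z : C}
    (x : X ⟶ Y) (y : Y ⟶ Z) (δ : Ext E Z X) : Prop :=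
  s δ = Quotient.mk (Seq.setoid X Z) ⟨Y, x, y⟩

section Additive

variable [Preadditive C] [HasFiniteBiproducts C]

/-- The direct sum `δ ⊕ δ' ∈ 𝔼(Z ⊞ Z', X ⊞ X')` of two extensions, that is, the element with
components `(δ, 0, 0, δ')` under
`𝔼(Z ⊞ Z', X ⊞ X') ≅ 𝔼(Z, X) ⊕ 𝔼(Z, X') ⊕ 𝔼(Z', X) ⊕ 𝔼(Z', X')`. -/
def extSum (E : Cᵒᵖ ⥤ C ⥤ AddCommGrpCat.{w}) {Z X Z' X' : C} (δ : Ext E Z X)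
    (δ' : Ext E Z' X') : Ext E (Z ⊞ Z') (X ⊞ X') :=
  push E biprod.inl (pull E biprod.fst δ) + push E biprod.inr (pull E biprod.snd δ')

/-- `(C, 𝔼, 𝔰)` is an extriangulated category in the sense of Nakaoka and Palu. -/
structure IsExtriangulated (E : Cᵒᵖ ⥤ C ⥤ AddCommGrpCat.{w}) (s : Correspondence E) : Prop where
  /-- (ET1), covariant variable -/
  push_add : ∀ {Z X X' : C} (a b : X ⟶ X') (δ : Ext E Z X),
    push E (a + b) δ = push E a δ + push E b δ
  /-- (ET1), contravariant variable -/
  pull_add : ∀ {Z Z' X : C} (a b : Z' ⟶ Z) (δ : Ext E Z X),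
    pull E (a + b) δ = pull E a δ + pull E b δ
  /-- (ET2), `𝔰` is a realization -/
  realize : ∀ {X Y Z X' Y' Z' : C} {x : X ⟶ Y} {y : Y ⟶ Z} {δ : Ext E Z X}
    {x' : X' ⟶ Y'} {y' : Y' ⟶ Z'} {δ' : Ext E Z' X'},
    IsTriangle s x y δ → IsTriangle s x' y' δ' →
    ∀ (a : X ⟶ X') (c : Z ⟶ Z'), push E a δ = pull E c δ' →
      ∃ b : Y ⟶ Y', x ≫ b = a ≫ x' ∧ y ≫ c = b ≫ y'
  /-- (ET2), the zero extension is realized by the split sequence -/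
  realize_zero : ∀ X Z : C,
    IsTriangle s (biprod.inl : X ⟶ X ⊞ Z) (biprod.snd : X ⊞ Z ⟶ Z) (0 : Ext E Z X)
  /-- (ET2), `𝔰(δ ⊕ δ') = 𝔰(δ) ⊕ 𝔰(δ')` -/
  realize_sum : ∀ {X Y Z X' Y' Z' : C} {x : X ⟶ Y} {y : Y ⟶ Z} {δ : Ext E Z X}
    {x' : X' ⟶ Y'} {y' : Y' ⟶ Z'} {δ' : Ext E Z' X'},
    IsTriangle s x y δ → IsTriangle s x' y' δ' →
    IsTriangle s (biprod.map x x') (biprod.map y y') (extSum E δ δ')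
  /-- (ET3) -/
  et3 : ∀ {X Y Z X' Y' Z' : C} {x : X ⟶ Y} {y : Y ⟶ Z} {δ : Ext E Z X}
    {x' : X' ⟶ Y'} {y' : Y' ⟶ Z'} {δ' : Ext E Z' X'},
    IsTriangle s x y δ → IsTriangle s x' y' δ' →
    ∀ (a : X ⟶ X') (b : Y ⟶ Y'), x ≫ b = a ≫ x' →
      ∃ c : Z ⟶ Z', y ≫ c = b ≫ y' ∧ push E a δ = pull E c δ'
  /-- (ET3)ᵒᵖ -/
  et3_op : ∀ {X Y Z X' Y' Z' : C} {x : X ⟶ Y} {y : Y ⟶ Z} {δ : Ext E Z X}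
    {x' : X' ⟶ Y'} {y' : Y' ⟶ Z'} {δ' : Ext E Z' X'},
    IsTriangle s x y δ → IsTriangle s x' y' δ' →
    ∀ (b : Y ⟶ Y') (c : Z ⟶ Z'), y ≫ c = b ≫ y' →
      ∃ a : X ⟶ X', x ≫ b = a ≫ x' ∧ push E a δ = pull E c δ'
  /-- (ET4) -/
  et4 : ∀ {A B D K F : C} {f : A ⟶ B} {f' : B ⟶ D} {δ : Ext E D A}
    {g : B ⟶ K} {g' : K ⟶ F} {δ' : Ext E F B},
    IsTriangle s f f' δ → IsTriangle s g g' δ' →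
    ∃ (G : C) (h' : K ⟶ G) (d : D ⟶ G) (e : G ⟶ F) (δ'' : Ext E G A),
      f' ≫ d = g ≫ h' ∧ h' ≫ e = g' ∧
      IsTriangle s (f ≫ g) h' δ'' ∧
      IsTriangle s d e (push E f' δ') ∧
      pull E d δ'' = δ ∧
      push E f δ'' = pull E e δ'
  /-- (ET4)ᵒᵖ -/
  et4_op : ∀ {D A B F K : C} {f' : D ⟶ A} {f : A ⟶ B} {δ : Ext E B D}
    {g' : F ⟶ B} {g : B ⟶ K} {δ' : Ext E K F},
    IsTriangle s f' f δ → IsTriangle s g' g δ' →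
    ∃ (G : C) (d : D ⟶ G) (e : G ⟶ F) (h' : G ⟶ A) (δ'' : Ext E K G),
      d ≫ h' = f' ∧ h' ≫ f = e ≫ g' ∧
      IsTriangle s h' (f ≫ g) δ'' ∧
      IsTriangle s d e (pull E g' δ) ∧
      push E e δ'' = δ' ∧
      push E d δ = pull E g δ''

end Additive

/-! ### Length functions and length categories -/

/-- The set of isomorphism classes of objects. -/
abbrev IsoClasses (C : Type u) [Category.{v} C] := Quotient (isIsomorphicSetoid C)

/-- The value of `Θ` at (the isomorphism class of) an object. -/
def len (Θ : IsoClasses C → ℕ) (X : C) : ℕ := Θ (Quotient.mk (isIsomorphicSetoid C) X)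

/-- `Θ` is a length function on `(C, 𝔼, 𝔰)`. -/
structure IsLengthFunction {E : Cᵒᵖ ⥤ C ⥤ AddCommGrpCat.{w}} (s : Correspondence E)
    (Θ : IsoClasses C → ℕ) : Prop where
  len_eq_zero_iff : ∀ X : C, len Θ X = 0 ↔ IsZero X
  len_le : ∀ {X L M : C} {x : X ⟶ L} {y : L ⟶ M} {δ : Ext E M X},
    IsTriangle s x y δ → len Θ L ≤ len Θ X + len Θ M
  len_eq_of_zero : ∀ {X L M : C} {x : X ⟶ L} {y : L ⟶ M},
    IsTriangle s x y (0 : Ext E M X) → len Θ L = len Θ X + len Θ M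

/-- The `𝔼`-triangle `X ⟶ L ⟶ M ⇢` is `Θ`-stable. -/
def IsStableTriangle {E : Cᵒᵖ ⥤ C ⥤ AddCommGrpCat.{w}} (s : Correspondence E)
    (Θ : IsoClasses C → ℕ) {X L M : C} (x : X ⟶ L) (y : L ⟶ M) (δ : Ext E M X) : Prop :=
  IsTriangle s x y δ ∧ len Θ L = len Θ X + len Θ M

/-- The morphism `x` is a `Θ`-inflation. -/
def IsThetaInflation {E : Cᵒᵖ ⥤ C ⥤ AddCommGrpCat.{w}} (s : Correspondence E)
    (Θ : IsoClasses C → ℕ) {X L : C} (x : X ⟶ L) : Prop :=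
  ∃ (M : C) (y : L ⟶ M) (δ : Ext E M X), IsStableTriangle s Θ x y δ

/-- The morphism `y` is a `Θ`-deflation. -/
def IsThetaDeflation {E : Cᵒᵖ ⥤ C ⥤ AddCommGrpCat.{w}} (s : Correspondence E)
    (Θ : IsoClasses C → ℕ) {L M : C} (y : L ⟶ M) : Prop :=
  ∃ (X : C) (x : X ⟶ L) (δ : Ext E M X), IsStableTriangle s Θ x y δ

/-- The extension `δ` is a `Θ`-extension. -/
def IsThetaExtension {E : Cᵒᵖ ⥤ C ⥤ AddCommGrpCat.{w}} (s : Correspondence E)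
    (Θ : IsoClasses C → ℕ) {M X : C} (δ : Ext E M X) : Prop :=
  ∃ (L : C) (x : X ⟶ L) (y : L ⟶ M), IsStableTriangle s Θ x y δ

/-- The morphism `f` is `Θ`-admissible: it is a `Θ`-deflation followed by a `Θ`-inflation. -/
def IsThetaAdmissible {E : Cᵒᵖ ⥤ C ⥤ AddCommGrpCat.{w}} (s : Correspondence E)
    (Θ : IsoClasses C → ℕ) {M N : C} (f : M ⟶ N) : Prop :=
  ∃ (X : C) (i : M ⟶ X) (j : X ⟶ N),
    IsThetaDeflation s Θ i ∧ IsThetaInflation s Θ j ∧ i ≫ j = f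

/-- `((C, 𝔼, 𝔰), Θ)` is an extriangulated length category. -/
structure IsLengthCategory [Preadditive C] [HasFiniteBiproducts C]
    (E : Cᵒᵖ ⥤ C ⥤ AddCommGrpCat.{w}) (s : Correspondence E) (Θ : IsoClasses C → ℕ) :
    Prop where
  extriangulated : IsExtriangulated E s
  lengthFunction : IsLengthFunction s Θ
  admissible : ∀ {M N : C} (f : M ⟶ N), IsThetaAdmissible s Θ f

/-- `((C, 𝔼, 𝔰), Θ)` is a stable length category: a length category whose length function is
additive on all `𝔼`-triangles. -/
structure IsStableLengthCategory [Preadditive C] [HasFiniteBiproducts C]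
    (E : Cᵒᵖ ⥤ C ⥤ AddCommGrpCat.{w}) (s : Correspondence E) (Θ : IsoClasses C → ℕ) : Prop
    extends IsLengthCategory E s Θ where
  stable : ∀ {X L M : C} {x : X ⟶ L} {y : L ⟶ M} {δ : Ext E M X},
    IsTriangle s x y δ → len Θ L = len Θ X + len Θ M

/-! ### Additive subfunctors and the restricted structure -/

/-- The subsets `F Z X ⊆ 𝔼(Z, X)` form an additive subfunctor of `𝔼`. -/
structure IsAdditiveSubfunctor (E : Cᵒᵖ ⥤ C ⥤ AddCommGrpCat.{w})
    (F : ∀ Z X : C, Set (Ext E Z X)) : Prop where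
  zero_mem : ∀ Z X : C, (0 : Ext E Z X) ∈ F Z X
  add_mem : ∀ {Z X : C} {δ δ' : Ext E Z X}, δ ∈ F Z X → δ' ∈ F Z X → δ + δ' ∈ F Z X
  neg_mem : ∀ {Z X : C} {δ : Ext E Z X}, δ ∈ F Z X → -δ ∈ F Z X
  push_mem : ∀ {Z X X' : C} (a : X ⟶ X') {δ : Ext E Z X}, δ ∈ F Z X → push E a δ ∈ F Z X'
  pull_mem : ∀ {Z Z' X : C} (c : Z' ⟶ Z) {δ : Ext E Z X}, δ ∈ F Z X → pull E c δ ∈ F Z' X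

namespace IsAdditiveSubfunctor

variable {E : Cᵒᵖ ⥤ C ⥤ AddCommGrpCat.{w}} {F : ∀ Z X : C, Set (Ext E Z X)}

/-- The subgroup `F Z X` of `𝔼(Z, X)`. -/
def subgroup (h : IsAdditiveSubfunctor E F) (Z X : C) : AddSubgroup (Ext E Z X) where
  carrier := F Z X
  zero_mem' := h.zero_mem Z X
  add_mem' := h.add_mem
  neg_mem' := h.neg_mem

/-- An additive subfunctor as a bifunctor to abelian groups, with the maps restricted
from `𝔼`. -/
def bifunctor (h : IsAdditiveSubfunctor E F) : Cᵒᵖ ⥤ C ⥤ AddCommGrpCat.{w} where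
  obj Z :=
    { obj := fun X => AddCommGrpCat.of (h.subgroup Z.unop X)
      map := fun {X X'} a => AddCommGrpCat.ofHom
        ((((E.obj Z).map a).hom.comp (h.subgroup Z.unop X).subtype).codRestrict
          (h.subgroup Z.unop X') fun δ => h.push_mem a δ.2)
      map_id := by
        intro X
        ext δ
        change ((E.obj Z).map (𝟙 X)).hom δ.1 = δ.1
        simp
      map_comp := by
        intro X X' X'' a b
        ext δ
        change ((E.obj Z).map (a ≫ b)).hom δ.1 = ((E.obj Z).map b).hom (((E.obj Z).map a).hom δ.1)
        simp }
  map {Z Z'} c :=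
    { app := fun X => AddCommGrpCat.ofHom
        ((((E.map c).app X).hom.comp (h.subgroup Z.unop X).subtype).codRestrict
          (h.subgroup Z'.unop X) fun δ => h.pull_mem c.unop δ.2)
      naturality := by
        intro X X' a
        ext δ
        change ((E.map c).app X').hom (((E.obj Z).map a).hom δ.1) =
          ((E.obj Z').map a).hom (((E.map c).app X).hom δ.1)
        exact congrArg (fun φ => φ.hom δ.1) ((E.map c).naturality a) }
  map_id := by
    intro Z
    ext X δ
    change ((E.map (𝟙 Z)).app X).hom δ.1 = δ.1
    simp
  map_comp := by
    intro Z Z' Z'' c d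
    ext X δ
    change ((E.map (c ≫ d)).app X).hom δ.1 = ((E.map d).app X).hom (((E.map c).app X).hom δ.1)
    simp

/-- The restriction of `𝔰` to an additive subfunctor of `𝔼`. -/
def restrict (h : IsAdditiveSubfunctor E F) (s : Correspondence E) :
    Correspondence h.bifunctor :=
  fun Z X (δ : h.subgroup Z X) => s δ.1

end IsAdditiveSubfunctor

/-- The subset `𝔼_Θ(Z, X)` of `𝔼(Z, X)` of all `Θ`-extensions. -/
def thetaExt {E : Cᵒᵖ ⥤ C ⥤ AddCommGrpCat.{w}} (s : Correspondence E) (Θ : IsoClasses C → ℕ)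
    (Z X : C) : Set (Ext E Z X) :=
  {δ | IsThetaExtension s Θ δ}

/-- Krull–Schmidt categories: every object is a finite direct sum of objects with local
endomorphism rings. -/
def IsKrullSchmidt (C : Type u) [Category.{v} C] [Preadditive C] [HasFiniteBiproducts C] : Prop :=
  ∀ X : C, ∃ (n : ℕ) (Y : Fin n → C),
    (∀ i, IsLocalRing (End (Y i))) ∧ Nonempty (X ≅ ⨁ Y)

end Extri

end

/-! Stability is a property of the extension alone, since two realizations of the same extension
have isomorphic middle terms. The main point is that pushing out and pulling back preserve
`Θ`-extensions (`IsThetaExtension.push`, `IsThetaExtension.pull`). For `a : X ⟶ X'`, (ET4) applied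
to a split sequence and `δ ⊕ 0` places the middle term `G` of `a_* δ` in a second triangle `X ⟶ L ⊞
X' ⟶ G`. Subadditivity there bounds the length of `G` below by `len X' + len M`; subadditivity on
`a_* δ` gives the reverse bound.

Sums follow by the Baer formula and negatives by pushing along `-1`. In (ET4) for the restriction,
the only new claim is that `δ''` is a `Θ`-extension, which is a length count. -/

namespace Extri

/-! ### Functoriality of push and pull. -/

section PushPull

variable {C : Type u} [Category.{v} C] (E : Cᵒᵖ ⥤ C ⥤ AddCommGrpCat.{w})

theorem push_comp {Z X X' X'' : C} (a : X ⟶ X') (b : X' ⟶ X'') (δ : Ext E Z X) :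
    push E (a ≫ b) δ = push E b (push E a δ) := by
  simp [push]

theorem push_id {Z X : C} (δ : Ext E Z X) : push E (𝟙 X) δ = δ := by
  simp [push]

theorem pull_comp {Z Z' Z'' X : C} (c : Z' ⟶ Z) (d : Z'' ⟶ Z') (δ : Ext E Z X) :
    pull E (d ≫ c) δ = pull E d (pull E c δ) := by
  simp [pull]

theorem pull_id {Z X : C} (δ : Ext E Z X) : pull E (𝟙 Z) δ = δ := by
  simp [pull]

theorem push_pull {Z Z' X X' : C} (a : X ⟶ X') (c : Z' ⟶ Z) (δ : Ext E Z X) :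
    push E a (pull E c δ) = pull E c (push E a δ) :=
  (congrArg (fun φ => φ.hom δ) ((E.map c.op).naturality a)).symm

theorem push_ext_add {Z X X' : C} (a : X ⟶ X') (δ δ' : Ext E Z X) :
    push E a (δ + δ') = push E a δ + push E a δ' :=
  map_add _ _ _

theorem pull_ext_add {Z Z' X : C} (c : Z' ⟶ Z) (δ δ' : Ext E Z X) :
    pull E c (δ + δ') = pull E c δ + pull E c δ' :=
  map_add _ _ _

theorem push_ext_zero {Z X X' : C} (a : X ⟶ X') : push E a (0 : Ext E Z X) = 0 :=
  map_zero _

theorem pull_ext_zero {Z Z' X : C} (c : Z' ⟶ Z) : pull E c (0 : Ext E Z X) = 0 :=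
  map_zero _

end PushPull

/-! ### Stability as a property of the extension, and the inherited length structure. -/

section Triangles

variable {C : Type u} [Category.{v} C] {E : Cᵒᵖ ⥤ C ⥤ AddCommGrpCat.{w}} {s : Correspondence E}

/-- Every extension is realized by some triangle. -/
theorem exists_isTriangle (s : Correspondence E) {Z X : C} (δ : Ext E Z X) :
    ∃ (Y : C) (x : X ⟶ Y) (y : Y ⟶ Z), IsTriangle s x y δ := by
  obtain ⟨⟨Y, x, y⟩, h⟩ := Quotient.exists_rep (s δ)
  exact ⟨Y, x, y, h.symm⟩

/-- The middle term of a triangle may be replaced by an isomorphic object. -/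
theorem IsTriangle.mid_iso {X Y Y' Z : C} {x : X ⟶ Y} {y : Y ⟶ Z} {δ : Ext E Z X}
    (h : IsTriangle s x y δ) (e : Y ≅ Y') : IsTriangle s (x ≫ e.hom) (e.inv ≫ y) δ :=
  Eq.trans h (Quotient.sound ⟨e, rfl, by simp⟩)

variable {Θ : IsoClasses C → ℕ}

theorem len_congr (Θ : IsoClasses C → ℕ) {X Y : C} (e : X ≅ Y) : len Θ X = len Θ Y :=
  congrArg Θ (Quotient.sound ⟨e⟩)

/-- The length of the middle term depends only on the extension. -/
theorem IsThetaExtension.len_eq {X L M : C} {x : X ⟶ L} {y : L ⟶ M} {δ : Ext E M X}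
    (hδ : IsThetaExtension s Θ δ) (h : IsTriangle s x y δ) :
    len Θ L = len Θ X + len Θ M := by
  obtain ⟨L', x', y', h', hl⟩ := hδ
  obtain ⟨e, -, -⟩ := Quotient.exact (h.symm.trans h')
  exact (len_congr Θ e).trans hl

theorem len_eq_of_isTriangle_restrict (F : IsAdditiveSubfunctor E (thetaExt s Θ))
    {X L M : C} {x : X ⟶ L} {y : L ⟶ M} {δ : Ext F.bifunctor M X}
    (t : IsTriangle (F.restrict s) x y δ) :
    len Θ L = len Θ X + len Θ M :=
  IsThetaExtension.len_eq (s := s) δ.2 t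

/-- The same factorization works: the stable triangles witnessing it have `Θ`-extensions as their
classes. -/
theorem isThetaAdmissible_restrict (F : IsAdditiveSubfunctor E (thetaExt s Θ))
    {M N : C} {f : M ⟶ N} (hf : IsThetaAdmissible s Θ f) :
    IsThetaAdmissible (F.restrict s) Θ f := by
  obtain ⟨X, i, j, ⟨K, k, δ, t⟩, ⟨Q, q, δ', t'⟩, hij⟩ := hf
  exact ⟨X, i, j, ⟨K, k, ⟨δ, ⟨_, _, _, t⟩⟩, t⟩, ⟨Q, q, ⟨δ', ⟨_, _, _, t'⟩⟩, t'⟩, hij⟩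

theorem isLengthFunction_restrict (F : IsAdditiveSubfunctor E (thetaExt s Θ))
    (hl : IsLengthFunction s Θ) :
    IsLengthFunction (F.restrict s) Θ where
  len_eq_zero_iff := hl.len_eq_zero_iff
  len_le t := (len_eq_of_isTriangle_restrict F t).le
  len_eq_of_zero t := len_eq_of_isTriangle_restrict F t

end Triangles

variable {C : Type u} [Category.{v} C] [Preadditive C] [HasFiniteBiproducts C]
  {E : Cᵒᵖ ⥤ C ⥤ AddCommGrpCat.{w}} {s : Correspondence E} {Θ : IsoClasses C → ℕ}

/-- Baer sum: reduces closure under addition to direct sums, pushing along the codiagonal and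
pulling along the diagonal. -/
theorem add_eq_push_pull_extSum {Z X : C} (δ δ' : Ext E Z X) :
    δ + δ' = push E (biprod.desc (𝟙 X) (𝟙 X))
      (pull E (biprod.lift (𝟙 Z) (𝟙 Z)) (extSum E δ δ')) := by
  simp only [extSum, pull_ext_add, push_ext_add, ← push_pull, ← push_comp, ← pull_comp,
    biprod.inl_desc, biprod.inr_desc, biprod.lift_fst, biprod.lift_snd, push_id, pull_id]

namespace IsExtriangulated

theorem push_zero (h : IsExtriangulated E s) {Z X X' : C} (δ : Ext E Z X) :
    push E (0 : X ⟶ X') δ = 0 := by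
  simpa using h.push_add 0 0 δ

theorem push_neg_id (h : IsExtriangulated E s) {Z X : C} (δ : Ext E Z X) :
    push E (-𝟙 X) δ = -δ := by
  have := h.push_add (-𝟙 X) (𝟙 X) δ
  rw [neg_add_cancel, h.push_zero, push_id] at this
  exact eq_neg_of_add_eq_zero_left this.symm

/-! ### Exact sequences of a triangle, by comparison with split triangles. -/

section Exactness

variable {X Y Z : C} {x : X ⟶ Y} {y : Y ⟶ Z} {δ : Ext E Z X}

theorem pull_self (h : IsExtriangulated E s) (t : IsTriangle s x y δ) : pull E y δ = 0 := by
  obtain ⟨a, -, ha⟩ := h.et3_op (h.realize_zero X Y) t biprod.snd y rfl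
  rw [← ha, push_ext_zero]

theorem push_self (h : IsExtriangulated E s) (t : IsTriangle s x y δ) : push E x δ = 0 := by
  obtain ⟨c, -, hc⟩ := h.et3 t (h.realize_zero Y Z) x biprod.inl rfl
  rw [hc, pull_ext_zero]

/-- Exactness of `Hom(A, X) ⟶ Hom(A, Y) ⟶ Hom(A, Z)`. -/
theorem exists_lift_left (h : IsExtriangulated E s) (t : IsTriangle s x y δ) {A : C}
    (f : A ⟶ Y) (hf : f ≫ y = 0) : ∃ g : A ⟶ X, g ≫ x = f := by
  obtain ⟨a, ha, -⟩ := h.et3_op (h.realize_zero A A) t (biprod.fst ≫ f) 0 (by simp [hf])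
  exact ⟨a, by simpa using ha.symm⟩

/-- Exactness of `Hom(A, Y) ⟶ Hom(A, Z) ⟶ 𝔼(A, X)`. -/
theorem exists_lift_right (h : IsExtriangulated E s) (t : IsTriangle s x y δ) {A : C}
    (f : A ⟶ Z) (hf : pull E f δ = 0) : ∃ g : A ⟶ Y, g ≫ y = f := by
  obtain ⟨b, -, hb⟩ := h.realize (h.realize_zero X A) t 0 f (by rw [hf, push_ext_zero])
  exact ⟨biprod.inr ≫ b, by rw [Category.assoc, ← hb]; simp⟩

/-- Exactness of `Hom(Z, A) ⟶ Hom(Y, A) ⟶ Hom(X, A)`. -/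
theorem exists_desc_right (h : IsExtriangulated E s) (t : IsTriangle s x y δ) {A : C}
    (f : Y ⟶ A) (hf : x ≫ f = 0) : ∃ g : Z ⟶ A, y ≫ g = f := by
  obtain ⟨c, hc, -⟩ := h.et3 t (h.realize_zero A A) 0 (f ≫ biprod.inr)
    (by rw [← Category.assoc, hf]; simp)
  exact ⟨c, by simpa using hc⟩

/-- Exactness of `Hom(Y, A) ⟶ Hom(X, A) ⟶ 𝔼(Z, A)`. -/
theorem exists_desc_left (h : IsExtriangulated E s) (t : IsTriangle s x y δ) {A : C}
    (f : X ⟶ A) (hf : push E f δ = 0) : ∃ g : Y ⟶ A, x ≫ g = f := by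
  obtain ⟨b, hb, -⟩ := h.realize t (h.realize_zero A Z) f 0 (by rw [hf, pull_ext_zero])
  exact ⟨b ≫ biprod.fst, by rw [← Category.assoc, hb]; simp⟩

/-- Triangles on isomorphic extensions have isomorphic middle terms. -/
theorem nonempty_mid_iso (h : IsExtriangulated E s) {X' Y' Z' : C} {x' : X' ⟶ Y'} {y' : Y' ⟶ Z'}
    {δ' : Ext E Z' X'} (t : IsTriangle s x y δ) (t' : IsTriangle s x' y' δ') (a : X ≅ X')
    (c : Z ≅ Z') (hac : push E a.hom δ = pull E c.hom δ') : Nonempty (Y ≅ Y') := by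
  have hδ : δ = push E a.inv (pull E c.hom δ') := by
    rw [← hac, ← push_comp, a.hom_inv_id, push_id]
  have hδ' : δ' = pull E c.inv (push E a.hom δ) := by
    rw [hac, ← pull_comp, c.inv_hom_id, pull_id]
  obtain ⟨b, hb₁, hb₂⟩ := h.realize t t' a.hom c.hom hac
  -- A lift `g` of `y' ≫ c.inv` along `y` inverts `b` up to an error killed by `y'`. The error
  -- factors through `x'` and is corrected via `a.inv ≫ x`; `left_inv` is dual.
  have right_inv : ∃ g : Y' ⟶ Y, g ≫ b = 𝟙 Y' := by
    obtain ⟨g, hg⟩ := h.exists_lift_right t (y' ≫ c.inv) (by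
      rw [hδ, ← push_pull, ← pull_comp, Category.assoc, c.inv_hom_id, Category.comp_id,
        h.pull_self t', push_ext_zero])
    obtain ⟨r, hr⟩ := h.exists_lift_left t' (𝟙 Y' - g ≫ b) (by
      rw [Preadditive.sub_comp, Category.assoc, ← hb₂, reassoc_of% hg]
      simp)
    refine ⟨g + r ≫ a.inv ≫ x, ?_⟩
    rw [Preadditive.add_comp, Category.assoc, Category.assoc, hb₁, a.inv_hom_id_assoc, hr]
    abel
  have left_inv : ∃ k : Y' ⟶ Y, b ≫ k = 𝟙 Y := by
    obtain ⟨k, hk⟩ := h.exists_desc_left t' (a.inv ≫ x) (by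
      rw [hδ', push_pull, ← push_comp, a.hom_inv_id_assoc, h.push_self t, pull_ext_zero])
    obtain ⟨r, hr⟩ := h.exists_desc_right t (𝟙 Y - b ≫ k) (by
      rw [Preadditive.comp_sub, reassoc_of% hb₁, hk]
      simp)
    refine ⟨k + y' ≫ c.inv ≫ r, ?_⟩
    rw [Preadditive.comp_add, ← reassoc_of% hb₂, c.hom_inv_id_assoc, hr]
    abel
  obtain ⟨g, hg⟩ := right_inv
  obtain ⟨k, hk⟩ := left_inv
  have hkg : k = g := by
    calc k = (g ≫ b) ≫ k := by rw [hg, Category.id_comp]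
      _ = g := by rw [Category.assoc, hk, Category.comp_id]
  exact ⟨⟨b, g, hkg ▸ hk, hg⟩⟩

end Exactness

/-- The sequence `X ⟶ X ⊞ X' ⟶ X'` with morphisms `(1, -a)` and `(a, 1)` is split. -/
theorem isTriangle_graph (h : IsExtriangulated E s) {X X' : C} (a : X ⟶ X') :
    IsTriangle s (biprod.lift (𝟙 X) (-a)) (biprod.desc a (𝟙 X')) (0 : Ext E X' X) := by
  -- A shear automorphism carries the standard split sequence to this one.
  let e : X ⊞ X' ≅ X ⊞ X' :=
    { hom := biprod.desc (biprod.lift (𝟙 X) (-a)) biprod.inr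
      inv := biprod.desc (biprod.lift (𝟙 X) a) biprod.inr
      hom_inv_id := by
        ext <;> simp [biprod.lift_desc]
      inv_hom_id := by
        ext <;> simp [biprod.lift_desc] }
  convert (h.realize_zero X X').mid_iso e using 1
  · simp [e]
  · ext <;> simp [e]

/-- The sequence `M' ⟶ M ⊞ M' ⟶ M` with morphisms `(c, 1)` and `(1, -c)` is split. -/
theorem isTriangle_cograph (h : IsExtriangulated E s) {M M' : C} (c : M' ⟶ M) :
    IsTriangle s (biprod.lift c (𝟙 M')) (biprod.desc (𝟙 M) (-c)) (0 : Ext E M M') := by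
  let e : M' ⊞ M ≅ M ⊞ M' :=
    { hom := biprod.desc (biprod.lift c (𝟙 M')) biprod.inl
      inv := biprod.desc biprod.inr (biprod.lift (𝟙 M') (-c))
      hom_inv_id := by
        ext <;> simp [biprod.lift_desc]
      inv_hom_id := by
        ext <;> simp [biprod.lift_desc] }
  convert (h.realize_zero M' M).mid_iso e using 1
  · simp [e]
  · ext <;> simp [e]

end IsExtriangulated

/-! ### Closure properties of `Θ`-extensions. -/

section Length

open ZeroObject

attribute [local instance] hasZeroObject_of_hasFiniteBiproducts

theorem len_biprod (h : IsExtriangulated E s) (hl : IsLengthFunction s Θ) (X Y : C) :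
    len Θ (X ⊞ Y) = len Θ X + len Θ Y :=
  hl.len_eq_of_zero (h.realize_zero X Y)

theorem len_zero (hl : IsLengthFunction s Θ) : len Θ (0 : C) = 0 :=
  (hl.len_eq_zero_iff 0).2 (isZero_zero C)

theorem isThetaExtension_zero (h : IsExtriangulated E s) (hl : IsLengthFunction s Θ) (Z X : C) :
    IsThetaExtension s Θ (0 : Ext E Z X) :=
  ⟨_, _, _, h.realize_zero X Z, len_biprod h hl X Z⟩

namespace IsThetaExtension

/-- Used to discard the zero summands that (ET4) leaves in `push` and `pull`. -/
theorem of_iso (h : IsExtriangulated E s) {X X' Z Z' : C} {δ : Ext E Z X} {δ' : Ext E Z' X'}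
    (hδ : IsThetaExtension s Θ δ) (a : X ≅ X') (c : Z ≅ Z')
    (hac : push E a.hom δ = pull E c.hom δ') : IsThetaExtension s Θ δ' := by
  obtain ⟨L, x, y, t, hlen⟩ := hδ
  obtain ⟨L', x', y', t'⟩ := exists_isTriangle s δ'
  obtain ⟨e⟩ := h.nonempty_mid_iso t t' a c hac
  exact ⟨L', x', y', t', by
    rw [← len_congr Θ e, ← len_congr Θ a, ← len_congr Θ c, hlen]⟩

theorem extSum (h : IsExtriangulated E s) (hl : IsLengthFunction s Θ) {X X' Z Z' : C}
    {δ : Ext E Z X} {δ' : Ext E Z' X'} (hδ : IsThetaExtension s Θ δ)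
    (hδ' : IsThetaExtension s Θ δ') : IsThetaExtension s Θ (extSum E δ δ') := by
  obtain ⟨L, x, y, t, hlen⟩ := hδ
  obtain ⟨L', x', y', t', hlen'⟩ := hδ'
  refine ⟨_, _, _, h.realize_sum t t', ?_⟩
  simp only [len_biprod h hl]
  omega

theorem push (h : IsExtriangulated E s) (hl : IsLengthFunction s Θ) {X X' Z : C}
    (a : X ⟶ X') {δ : Ext E Z X} (hδ : IsThetaExtension s Θ δ) :
    IsThetaExtension s Θ (push E a δ) := by
  obtain ⟨L, x, y, t, hlen⟩ := hδ
  -- `t₂` realizes `(a, 1)_* (δ ⊕ 0)`, which is `a_* δ` up to `M ≅ M ⊞ 0`; `t₁` has ends `X` and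
  -- `G`, hence bounds `G` from below.
  obtain ⟨G, h', d, e, δ'', -, -, t₁, t₂, -, -⟩ :=
    h.et4 (h.isTriangle_graph a) (h.realize_sum t (h.realize_zero X' 0))
  have le₁ := hl.len_le t₁
  have le₂ := hl.len_le t₂
  simp only [len_biprod h hl, len_zero hl] at le₁ le₂
  refine of_iso h ⟨_, _, _, t₂, ?_⟩ (Iso.refl X') (isoBiprodZero (isZero_zero C)).symm ?_
  · simp only [len_biprod h hl, len_zero hl]
    omega
  · simp [Extri.extSum, pull_ext_zero, push_ext_zero, push_pull, ← push_comp]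

theorem pull (h : IsExtriangulated E s) (hl : IsLengthFunction s Θ) {X Z Z' : C}
    (c : Z' ⟶ Z) {δ : Ext E Z X} (hδ : IsThetaExtension s Θ δ) :
    IsThetaExtension s Θ (pull E c δ) := by
  obtain ⟨L, x, y, t, hlen⟩ := hδ
  -- Dually, `t₂` realizes `c^* δ` up to `X ≅ X ⊞ 0`, and `t₁` has ends `G` and `Z`.
  obtain ⟨G, d, e, h', δ'', -, -, t₁, t₂, -, -⟩ :=
    h.et4_op (h.realize_sum t (h.realize_zero 0 Z')) (h.isTriangle_cograph c)
  have le₁ := hl.len_le t₁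
  have le₂ := hl.len_le t₂
  simp only [len_biprod h hl, len_zero hl] at le₁ le₂
  refine of_iso h ⟨_, _, _, t₂, ?_⟩ (isoBiprodZero (isZero_zero C)).symm (Iso.refl Z') ?_
  · simp only [len_biprod h hl, len_zero hl]
    omega
  · simp [Extri.extSum, pull_ext_zero, push_ext_zero, push_id, ← push_pull, ← push_comp,
      ← pull_comp]

theorem neg (h : IsExtriangulated E s) (hl : IsLengthFunction s Θ) {X Z : C}
    {δ : Ext E Z X} (hδ : IsThetaExtension s Θ δ) : IsThetaExtension s Θ (-δ) :=
  h.push_neg_id δ ▸ hδ.push h hl (-𝟙 X)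

theorem add (h : IsExtriangulated E s) (hl : IsLengthFunction s Θ) {X Z : C}
    {δ δ' : Ext E Z X} (hδ : IsThetaExtension s Θ δ) (hδ' : IsThetaExtension s Θ δ') :
    IsThetaExtension s Θ (δ + δ') :=
  add_eq_push_pull_extSum δ δ' ▸ ((hδ.extSum h hl hδ').pull h hl _).push h hl _

end IsThetaExtension

/-- The `Θ`-extensions form an additive subfunctor of `𝔼`. -/
theorem isAdditiveSubfunctor_thetaExt (h : IsExtriangulated E s) (hl : IsLengthFunction s Θ) :
    IsAdditiveSubfunctor E (thetaExt s Θ) where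
  zero_mem := isThetaExtension_zero h hl
  add_mem hδ hδ' := hδ.add h hl hδ'
  neg_mem hδ := hδ.neg h hl
  push_mem a _ hδ := hδ.push h hl a
  pull_mem c _ hδ := hδ.pull h hl c

end Length

/-- The restriction of an extriangulated structure to the `Θ`-extensions is extriangulated. -/
theorem isExtriangulated_restrict (F : IsAdditiveSubfunctor E (thetaExt s Θ))
    (h : IsExtriangulated E s) :
    IsExtriangulated F.bifunctor (F.restrict s) where
  push_add a b δ := Subtype.ext (h.push_add a b δ.1)
  pull_add a b δ := Subtype.ext (h.pull_add a b δ.1)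
  -- Triangles of the restriction are, by definition, triangles of `s` on the underlying extensions.
  realize t t' a c hac := h.realize t t' a c (congrArg Subtype.val hac)
  realize_zero := h.realize_zero
  realize_sum t t' := h.realize_sum t t'
  et3 t t' a b hab := by
    obtain ⟨c, hc, hc'⟩ := h.et3 t t' a b hab
    exact ⟨c, hc, Subtype.ext hc'⟩
  et3_op t t' b c hbc := by
    obtain ⟨a, ha, ha'⟩ := h.et3_op t t' b c hbc
    exact ⟨a, ha, Subtype.ext ha'⟩
  et4 {A B D K F' f f' δ g g' δ'} t t' := by
    obtain ⟨G, h', d, e, δ'', h₁, h₂, t₁, t₂, h₃, h₄⟩ := h.et4 t t'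
    have l := len_eq_of_isTriangle_restrict F t
    have l' := len_eq_of_isTriangle_restrict F t'
    -- `f'_* δ'` is again a `Θ`-extension, so `t₂` is stable. Then `len K = len A + len D + len F' =
    -- len A + len G`, so `t₁` is stable too.
    have l₂ : len Θ G = len Θ D + len Θ F' :=
      IsThetaExtension.len_eq (F.push_mem f' δ'.2) t₂
    have hδ'' : IsThetaExtension s Θ δ'' := ⟨_, _, _, t₁, by omega⟩
    exact ⟨G, h', d, e, ⟨δ'', hδ''⟩, h₁, h₂, t₁, t₂, Subtype.ext h₃, Subtype.ext h₄⟩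
  et4_op {D A B F' K f' f δ g' g δ'} t t' := by
    obtain ⟨G, d, e, h', δ'', h₁, h₂, t₁, t₂, h₃, h₄⟩ := h.et4_op t t'
    have l := len_eq_of_isTriangle_restrict F t
    have l' := len_eq_of_isTriangle_restrict F t'
    -- Here closure under pulling along `g'` makes `t₂` stable, and the same count applies to `t₁`.
    have l₂ : len Θ G = len Θ D + len Θ F' :=
      IsThetaExtension.len_eq (F.pull_mem g' δ.2) t₂
    have hδ'' : IsThetaExtension s Θ δ'' := ⟨_, _, _, t₁, by omega⟩
    exact ⟨G, d, e, h', ⟨δ'', hδ''⟩, h₁, h₂, t₁, t₂, Subtype.ext h₃, Subtype.ext h₄⟩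

end Extri

theorem proposition3 {C : Type u} [Category.{v} C] [Preadditive C] [HasFiniteBiproducts C]
    (hKS : Extri.IsKrullSchmidt C)
    (E : Cᵒᵖ ⥤ C ⥤ AddCommGrpCat.{w}) (s : Extri.Correspondence E)
    (Θ : Extri.IsoClasses C → ℕ) (hΘ : Extri.IsLengthCategory E s Θ) :
    ∃ h : Extri.IsAdditiveSubfunctor E (Extri.thetaExt s Θ),
      Extri.IsStableLengthCategory h.bifunctor (h.restrict s) Θ := by
  have h := hΘ.extriangulated
  have hl := hΘ.lengthFunction
  let F := Extri.isAdditiveSubfunctor_thetaExt h hl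
  exact ⟨F,
    { extriangulated := Extri.isExtriangulated_restrict F h
      lengthFunction := Extri.isLengthFunction_restrict F hl
      admissible := fun f => Extri.isThetaAdmissible_restrict F (hΘ.admissible f)
      stable := fun t => Extri.len_eq_of_isTriangle_restrict F t }⟩
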